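/- Let $S_1,\dots,S_n$ ($n\ge 1$) be Pauli strings on $m$ qubits, i.e. tensor products of $m$ factors from $\{\mathbb 1,X,Y,Z\}$, and let $G$ be their frustration graph: the graph on $\{1,\dots,n\}$ in which $i\ne j$ are adjacent if and only if $S_i$ and $S_j$ anti-commute. Let $\mathcal D=\{w\in\mathbb R^n: w_i\ge 0,\ \sum_i w_i=1\}$. For $w\in\mathbb R_{\ge0}^n$ put $\beta(G,w)=\sup_\rho\sum_i w_i\,(\operatorname{tr}\rho S_i)^2$, the supremum being over all density matrices $\rho$ (this number depends only on $G$ and $w$), and let $$\delta(\{S_i\})=\min_{w\in\mathcal D}\ \max_{\|\psi\|=1}\ \sum_i w_i\,\langle\psi|S_i|\psi\rangle^2$$ be the sample complexity index of shadow tomography. Let $\bar G$ be the complement of $G$. For a graph $H$ with vertices $1,\dots,n$ let $\alpha^*(H)$ be its fractional packing number, the maximum of $\sum_i w_i$ over all $w\in\mathbb R_{\ge0}^n$ with $\sum_{i\in C}w_i\le 1$ for every clique $C$ of $H$; and let $\vartheta(H)$ be its Lovász number, the minimum of $\max_i \langle c,u_i\rangle^{-2}$ over all unit vectors $c,u_1,\dots,u_n$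 of a Euclidean space such that $u_i\perp u_j$ whenever $i\neq j$ are not adjacent in $H$. Then $$\delta(\{S_i\})=\min_{w\in\mathcal D}\beta(G,w)\in\left[\frac1{\alpha^*(\bar G)},\ \frac1{\vartheta(\bar G)}\right].$$ Call $G$ $\hbar$-perfect if $\mathrm{STAB}(G)=\mathrm{BETA}(G)$. Here $\mathrm{STAB}(G)$ is the convex hull of the indicator vectors of the independent sets of $G$. The set $\mathrm{BETA}(G)$ is $\mathrm{Conv}(\{x\in\mathbb R^n:\exists\rho\ \forall i\ x_i\le(\operatorname{tr}\rho S_i')^2\})\cap\mathbb R_{\ge0}^n$, where $S'_1,\dots,S'_n$ are any Pauli strings with frustration graph $G$ (it does not depend on their choice) and $\rho$ runs over the density matrices. If $G$ is $\hbar$-perfect, then $\delta(\{S_i\})=1/\alpha^*(\bar G)$. -/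

import Mathlib

noncomputable section

namespace PauliShadow

open scoped ComplexOrder

/-- The four single-qubit Pauli symbols. -/
inductive Pauli
  | I | X | Y | Z

/-- The Pauli matrices. -/
def Pauli.toMatrix : Pauli → Matrix (Fin 2) (Fin 2) ℂ
  | .I => !![1, 0; 0, 1]
  | .X => !![0, 1; 1, 0]
  | .Y => !![0, -Complex.I; Complex.I, 0]
  | .Z => !![1, 0; 0, -1]

/-- A Pauli string of length `m`: one Pauli symbol for each of the `m` qubits. -/
abbrev PauliString (m : ℕ) : Type := Fin m → Pauli

/-- The operator of a Pauli string on `m` qubits: the tensor product of its factors, written in the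
computational basis, which is indexed by the bit strings `Fin m → Fin 2`. -/
def PauliString.toMatrix {m : ℕ} (P : PauliString m) :
    Matrix (Fin m → Fin 2) (Fin m → Fin 2) ℂ :=
  Matrix.of fun a b => ∏ k, (P k).toMatrix (a k) (b k)

/-- Density matrices on a finite-dimensional Hilbert space with basis `d`. -/
def IsDensityMatrix {d : Type*} [Fintype d] (ρ : Matrix d d ℂ) : Prop :=
  ρ.PosSemidef ∧ ρ.trace = 1

/-- The expectation value `tr (ρ A)`, a real number for a Hermitian `A`. -/
def expectation {d : Type*} [Fintype d] (ρ A : Matrix d d ℂ) : ℝ :=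
  (ρ * A).trace.re

/-- The expectation value `⟨ψ| A |ψ⟩`, a real number for a Hermitian `A`. -/
def pureExpectation {d : Type*} [Fintype d] (ψ : EuclideanSpace ℂ d) (A : Matrix d d ℂ) : ℝ :=
  (∑ a, ∑ b, star (ψ a) * A a b * ψ b).re

/-- The frustration graph of a family of Pauli strings: distinct indices are adjacent exactly when
the corresponding operators anti-commute. -/
def frustrationGraph {ι : Type*} {m : ℕ} (S : ι → PauliString m) : SimpleGraph ι where
  Adj i j := i ≠ j ∧
    (S i).toMatrix * (S j).toMatrix = -((S j).toMatrix * (S i).toMatrix)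
  symm := ⟨fun _ _ h => ⟨h.1.symm, by rw [h.2, neg_neg]⟩⟩
  loopless := ⟨fun _ h => h.1 rfl⟩

/-- The weighted beta number: the supremum over all states `ρ` of `∑ i, w i * ⟨S i⟩_ρ ^ 2`. -/
def weightedBeta {ι : Type*} [Fintype ι] {m : ℕ} (S : ι → PauliString m) (w : ι → ℝ) : ℝ :=
  ⨆ ρ : {ρ : Matrix (Fin m → Fin 2) (Fin m → Fin 2) ℂ // IsDensityMatrix ρ},
    ∑ i, w i * expectation ρ.1 (S i).toMatrix ^ 2

/-- The sample complexity index of shadow tomography: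
the minimum over probability vectors `w` of the maximum over unit vectors `ψ` of
`∑ i, w i * ⟨ψ| S i |ψ⟩ ^ 2`. -/
def sampleComplexityIndex {ι : Type*} [Fintype ι] {m : ℕ} (S : ι → PauliString m) : ℝ :=
  ⨅ w : stdSimplex ℝ ι, ⨆ ψ : Metric.sphere (0 : EuclideanSpace ℂ (Fin m → Fin 2)) 1,
    ∑ i, w.1 i * pureExpectation ψ.1 (S i).toMatrix ^ 2

/-- The joint variance range: all tuples `(⟨S i⟩_ρ ^ 2)_i` for states `ρ`. -/
def varianceRange {ι : Type*} {m : ℕ} (S : ι → PauliString m) : Set (ι → ℝ) :=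
  {q | ∃ ρ : Matrix (Fin m → Fin 2) (Fin m → Fin 2) ℂ, IsDensityMatrix ρ ∧
    ∀ i, q i = expectation ρ (S i).toMatrix ^ 2}

/-- The beta body of a realization `S`: the nonnegative part of the convex hull of the down-closure
of the joint variance range. -/
def betaBody {ι : Type*} {m : ℕ} (S : ι → PauliString m) : Set (ι → ℝ) :=
  convexHull ℝ (lowerClosure (varianceRange S) : Set (ι → ℝ)) ∩ {x | ∀ i, 0 ≤ x i}

/-- The stable set polytope: the convex hull of the `0`-`1` vectors supported on stable sets. -/
def stableSetPolytope {ι : Type*} (G : SimpleGraph ι) : Set (ι → ℝ) :=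
  convexHull ℝ {v | (∀ i, v i = 0 ∨ v i = 1) ∧ ∀ i j, G.Adj i j → v i * v j = 0}

/-- A graph is ħ-perfect when its stable set polytope is its beta body. All realizations of the
graph by Pauli strings have the same beta body, so it does not matter which one is used. -/
def IsHbarPerfect {ι : Type*} (G : SimpleGraph ι) : Prop :=
  ∃ (m : ℕ) (S : ι → PauliString m), frustrationGraph S = G ∧ stableSetPolytope G = betaBody S

/-- The fractional packing number: the maximum of `∑ i, w i` over nonnegative weights whose sum over
each clique is at most `1`. -/
def fractionalPackingNumber {ι : Type*} [Fintype ι] (G : SimpleGraph ι) : ℝ :=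
  sSup {t | ∃ w : ι → ℝ, (∀ i, 0 ≤ w i) ∧
    (∀ C : Finset ι, G.IsClique (C : Set ι) → ∑ i ∈ C, w i ≤ 1) ∧ t = ∑ i, w i}

/-- An orthonormal representation of a graph: unit vectors, orthogonal for any two distinct
non-adjacent vertices. -/
def IsOrthonormalRepresentation {ι : Type*} (G : SimpleGraph ι) {d : ℕ}
    (u : ι → EuclideanSpace ℝ (Fin d)) : Prop :=
  (∀ i, ‖u i‖ = 1) ∧ ∀ i j, i ≠ j → ¬ G.Adj i j → inner ℝ (u i) (u j) = 0

/-- The Lovász number: the minimum of `max_i 1 / ⟪c, u i⟫ ^ 2` over all orthonormal representations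
`u` of the graph and all unit vectors `c`. The value is infinite, hence irrelevant for the minimum,
if some `⟪c, u i⟫` vanishes. -/
def lovaszNumber {ι : Type*} (G : SimpleGraph ι) : ℝ :=
  sInf {t | ∃ (d : ℕ) (u : ι → EuclideanSpace ℝ (Fin d)) (c : EuclideanSpace ℝ (Fin d)),
    IsOrthonormalRepresentation G u ∧ ‖c‖ = 1 ∧ (∀ i, inner ℝ c (u i) ≠ 0) ∧
    t = ⨆ i, 1 / inner ℝ c (u i) ^ 2}

end PauliShadow

end

open PauliShadow

/-! A convexity argument shows that mixed states do not beat pure ones, so the index is an infimum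
of weighted beta numbers; lower semicontinuity and compactness of the simplex make it a minimum.

Lower bound: a clique of the complement is a commuting set, and a joint eigenstate makes all its
squared expectations 1. So `w / β(w)` is feasible for fractional packing
(`sum_le_weightedBeta_of_isClique`).

Upper bound: a mixture of pure states whose variance tuple has all coordinates at least `t > 0`
yields an orthonormal representation of the complement with value at most `1 / t`
(`le_one_div_lovaszNumber`). Hence no such tuple exceeds `1 / ϑ` everywhere, and separating
hyperplanes supply a good `w` (`exists_mem_stdSimplex_sum_mul_le`).

ħ-perfect case: a feasible packing `w` satisfies `w · x ≤ 1` on the stable set polytope, hence on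
the beta body, so `β(w) ≤ 1`; normalising `w` gives the reverse of the lower bound. Perfectness may
be witnessed by another realization `S'`, so `β` must depend on the graph alone: the operators `S' i
⊗ S i` all commute, and measuring them jointly carries states of one realization to the other. -/

namespace PauliShadow
open Matrix
open scoped ComplexOrder Kronecker

/-! ### Algebra of Pauli strings and joint spectral projections -/

theorem Pauli.toMatrix_mul_self (p : Pauli) : p.toMatrix * p.toMatrix = 1 := by
  cases p <;> ext i j <;> fin_cases i <;> fin_cases j <;>
    simp [Pauli.toMatrix, Matrix.mul_apply, Fin.sum_univ_two]

theorem Pauli.star_toMatrix_apply (p : Pauli) (a b : Fin 2) :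
    star (p.toMatrix a b) = p.toMatrix b a := by
  cases p <;> fin_cases a <;> fin_cases b <;> simp [Pauli.toMatrix]

/-- Two Pauli matrices commute up to a sign. -/
theorem Pauli.exists_sign (p q : Pauli) : ∃ s : ℂ, (s = 1 ∨ s = -1) ∧
    p.toMatrix * q.toMatrix = s • (q.toMatrix * p.toMatrix) := by
  cases p <;> cases q <;>
  first
  | (refine ⟨1, Or.inl rfl, ?_⟩
     ext i j; fin_cases i <;> fin_cases j <;>
      simp [Pauli.toMatrix, Matrix.mul_apply, Fin.sum_univ_two]
     done)
  | (refine ⟨-1, Or.inr rfl, ?_⟩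
     ext i j; fin_cases i <;> fin_cases j <;>
      simp [Pauli.toMatrix, Matrix.mul_apply, Fin.sum_univ_two])

namespace PauliString

variable {m : ℕ}

theorem toMatrix_mul_apply (P Q : PauliString m) (a b : Fin m → Fin 2) :
    (P.toMatrix * Q.toMatrix) a b =
      ∏ k, ((P k).toMatrix * (Q k).toMatrix) (a k) (b k) := by
  simp only [Matrix.mul_apply, PauliString.toMatrix, Matrix.of_apply, ← Finset.prod_mul_distrib]
  rw [Finset.prod_univ_sum, Fintype.piFinset_univ]

theorem toMatrix_mul_self (P : PauliString m) : P.toMatrix * P.toMatrix = 1 := by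
  ext a b
  rw [toMatrix_mul_apply]
  simp only [Pauli.toMatrix_mul_self, Matrix.one_apply]
  by_cases h : a = b
  · simp [h]
  · obtain ⟨k, hk⟩ := Function.ne_iff.1 h
    rw [if_neg h]
    exact Finset.prod_eq_zero (Finset.mem_univ k) (if_neg hk)

theorem isHermitian_toMatrix (P : PauliString m) : P.toMatrix.IsHermitian := by
  ext a b
  simp only [Matrix.conjTranspose_apply, PauliString.toMatrix, Matrix.of_apply, star_prod,
    Pauli.star_toMatrix_apply]

theorem mul_eq_or_eq_neg (P Q : PauliString m) :
    P.toMatrix * Q.toMatrix = Q.toMatrix * P.toMatrix ∨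
      P.toMatrix * Q.toMatrix = -(Q.toMatrix * P.toMatrix) := by
  choose s hs h using fun k => Pauli.exists_sign (P k) (Q k)
  have key : P.toMatrix * Q.toMatrix = (∏ k, s k) • (Q.toMatrix * P.toMatrix) := by
    ext a b
    rw [Matrix.smul_apply, toMatrix_mul_apply, toMatrix_mul_apply, smul_eq_mul,
      ← Finset.prod_mul_distrib]
    simp only [h, Matrix.smul_apply, smul_eq_mul]
  have hprod : (∏ k, s k) = 1 ∨ (∏ k, s k) = -1 :=
    Finset.prod_induction s (fun z => z = 1 ∨ z = -1)
      (by rintro _ _ (rfl | rfl) (rfl | rfl) <;> simp) (Or.inl rfl) (fun k _ => hs k)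
  rcases hprod with h1 | h1 <;> rw [h1] at key
  · exact Or.inl (by simpa using key)
  · exact Or.inr (by simpa using key)

end PauliString

/-- Pauli strings that are not joined in the frustration graph commute. -/
theorem commute_of_not_adj {ι : Type*} {m : ℕ} {S : ι → PauliString m} {i j : ι}
    (h : ¬ (frustrationGraph S).Adj i j) : Commute (S i).toMatrix (S j).toMatrix := by
  rcases eq_or_ne i j with rfl | hij
  · exact Commute.refl _
  · exact (PauliString.mul_eq_or_eq_neg (S i) (S j)).resolve_right fun h' => h ⟨hij, h'⟩

/-- Pairwise commuting Hermitian involutions have a joint spectral resolution. -/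
theorem exists_joint_projections {ι d : Type*} [Fintype d] [DecidableEq d]
    (T : ι → Matrix d d ℂ) (F : Finset ι) (hT : ∀ i ∈ F, (T i).IsHermitian)
    (hsq : ∀ i ∈ F, T i * T i = 1) (hcomm : ∀ i ∈ F, ∀ j ∈ F, Commute (T i) (T j)) :
    ∃ (K : Type) (_ : Fintype K) (P : K → Matrix d d ℂ) (σ : K → ι → ℝ),
      (∀ k, (P k).PosSemidef) ∧ (∑ k, P k = 1) ∧ (∀ k, ∀ i, σ k i = 1 ∨ σ k i = -1) ∧
      (∀ k, ∀ i ∈ F, T i * P k = (σ k i : ℂ) • P k) := by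
  classical
  -- The induction also carries that each `P k` commutes with whatever commutes with the family;
  -- this makes the next operator commute with the old projections.
  suffices h : ∃ (K : Type) (_ : Fintype K) (P : K → Matrix d d ℂ) (σ : K → ι → ℝ),
      (∀ k, (P k).IsHermitian ∧ P k * P k = P k) ∧ (∑ k, P k = 1) ∧
      (∀ k, ∀ i, σ k i = 1 ∨ σ k i = -1) ∧
      (∀ k, ∀ i ∈ F, T i * P k = (σ k i : ℂ) • P k) ∧
      ∀ X, (∀ i ∈ F, Commute X (T i)) → ∀ k, Commute X (P k) by
    obtain ⟨K, hK, P, σ, h1, h2, h3, h4, -⟩ := h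
    refine ⟨K, hK, P, σ, fun k => ?_, h2, h3, h4⟩
    have := posSemidef_conjTranspose_mul_self (P k)
    rwa [(h1 k).1.eq, (h1 k).2] at this
  induction F using Finset.induction_on with
  | empty =>
    exact ⟨Unit, inferInstance, fun _ => 1, fun _ _ => 1, by simp, by simp, by simp, by simp,
      fun X _ _ => Commute.one_right X⟩
  | insert a F ha ih =>
    obtain ⟨K, hK, P, σ, h1, h2, h3, h4, h5⟩ := ih
      (fun i hi => hT i (Finset.mem_insert_of_mem hi))
      (fun i hi => hsq i (Finset.mem_insert_of_mem hi))
      (fun i hi j hj => hcomm i (Finset.mem_insert_of_mem hi) j (Finset.mem_insert_of_mem hj))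
    have haI := Finset.mem_insert_self a F
    have haP : ∀ k, Commute (T a) (P k) := h5 (T a) fun i hi =>
      hcomm a haI i (Finset.mem_insert_of_mem hi)
    let e : Bool → ℝ := fun b => if b then 1 else -1
    have he : ∀ b, (e b : ℂ) * e b = 1 := by intro b; cases b <;> simp [e]
    -- The spectral projections of `T a` for the eigenvalues ±1. Some products `P k * E b` may
    -- vanish, which is harmless.
    let E : Bool → Matrix d d ℂ := fun b => (1 / 2 : ℂ) • (1 + (e b : ℂ) • T a)
    have hEE : ∀ b, E b * E b = E b := by
      intro b
      simp only [E, smul_mul_assoc, mul_smul_comm, mul_add, add_mul, mul_one, one_mul,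
        hsq a haI, smul_smul, smul_add]
      match_scalars
      · linear_combination (1 / 4 : ℂ) * he b
      · ring
    have hTE : ∀ b, T a * E b = (e b : ℂ) • E b := by
      intro b
      simp only [E, mul_smul_comm, mul_add, mul_one, hsq a haI, smul_add, smul_smul]
      rw [show (e b : ℂ) * (1 / 2 * e b) = 1 / 2 * (e b * e b) by ring, he, add_comm,
        mul_comm (1 / 2 : ℂ) (e b : ℂ), mul_one]
    have hEH : ∀ b, (E b).IsHermitian := by
      intro b
      have : (T a)ᴴ = T a := (hT a haI).eq
      simp [IsHermitian, E, conjTranspose_smul, this]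
    have hXE : ∀ X, Commute X (T a) → ∀ b, Commute X (E b) := by
      intro X hX b
      exact ((Commute.one_right X).add_right (hX.smul_right _)).smul_right _
    have hPE : ∀ k b, Commute (P k) (E b) := fun k b => hXE _ (haP k).symm b
    refine ⟨K × Bool, inferInstance, fun kb => P kb.1 * E kb.2,
      fun kb => Function.update (σ kb.1) a (e kb.2), ?_, ?_, ?_, ?_, ?_⟩
    · rintro ⟨k, b⟩
      refine ⟨?_, ?_⟩
      · rw [IsHermitian, conjTranspose_mul, (hEH b).eq, (h1 k).1.eq, ← (hPE k b).eq]
      · calc P k * E b * (P k * E b) = P k * (E b * P k) * E b := by simp only [mul_assoc]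
          _ = (P k * P k) * (E b * E b) := by rw [← (hPE k b).eq]; simp only [mul_assoc]
          _ = _ := by rw [(h1 k).2, hEE]
    · rw [Fintype.sum_prod_type]
      have : ∀ k, ∑ b, P k * E b = P k := by
        intro k
        rw [← Finset.mul_sum, Fintype.sum_bool]
        have : E true + E false = 1 := by simp [E, e]; module
        rw [this, mul_one]
      simp only [this, h2]
    · rintro ⟨k, b⟩ i
      rcases eq_or_ne i a with rfl | hi
      · cases b <;> simp [e]
      · simpa [hi] using h3 k i
    · rintro ⟨k, b⟩ i hi
      rcases eq_or_ne i a with rfl | hia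
      · simp only [Function.update_self]
        rw [← mul_assoc, (haP k).eq, mul_assoc, hTE, mul_smul_comm]
      · simp only [Function.update_of_ne hia]
        rw [← mul_assoc, h4 k i (Finset.mem_of_mem_insert_of_ne hi hia), smul_mul_assoc]
    · rintro X hX ⟨k, b⟩
      exact (h5 X (fun i hi => hX i (Finset.mem_insert_of_mem hi)) k).mul_right
        (hXE X (hX a haI) b)

theorem exists_conjTranspose_mul_self {d : Type*} [Fintype d] [DecidableEq d] {ρ : Matrix d d ℂ}
    (h : ρ.PosSemidef) : ∃ B : Matrix d d ℂ, ρ = Bᴴ * B := by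
  open scoped MatrixOrder in
  exact CStarAlgebra.nonneg_iff_eq_star_mul_self.1 h.nonneg

/-- Minkowski's inequality for a weighted quadratic form. -/
theorem sum_mul_sum_sq_le {ι K : Type*} [Fintype ι] [Fintype K] {w : ι → ℝ} (hw : ∀ i, 0 ≤ w i)
    {b : ℝ} {p : K → ℝ} (hp : ∀ k, 0 ≤ p k) {y : K → ι → ℝ}
    (h : ∀ k, ∑ i, w i * y k i ^ 2 ≤ b * p k ^ 2) :
    ∑ i, w i * (∑ k, y k i) ^ 2 ≤ b * (∑ k, p k) ^ 2 := by
  rcases isEmpty_or_nonempty K with hK | hK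
  · simp
  by_cases hb : 0 ≤ b
  -- Scaling coordinates by `√(w i)` turns the form into a squared Euclidean norm, so the triangle
  -- inequality applies.
  · let z : (ι → ℝ) → EuclideanSpace ℝ ι := fun y => WithLp.toLp 2 fun i => √(w i) * y i
    have hz : ∀ y, ‖z y‖ ^ 2 = ∑ i, w i * y i ^ 2 := fun y => by
      rw [EuclideanSpace.norm_sq_eq]
      refine Finset.sum_congr rfl fun i _ => ?_
      simp [z, mul_pow, Real.sq_sqrt (hw i)]
    have hzk : ∀ k, ‖z (y k)‖ ≤ √b * p k := fun k => by
      refine abs_le_of_sq_le_sq' ?_ (mul_nonneg (Real.sqrt_nonneg b) (hp k)) |>.2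
      rw [hz, mul_pow, Real.sq_sqrt hb]
      exact h k
    have hsum : z (fun i => ∑ k, y k i) = ∑ k, z (y k) := by
      ext i
      simp [z, Finset.mul_sum]
    rw [← hz, hsum]
    have := (norm_sum_le Finset.univ fun k => z (y k)).trans
      (Finset.sum_le_sum fun k _ => hzk k)
    rw [← Finset.mul_sum] at this
    calc _ ≤ (√b * ∑ k, p k) ^ 2 := pow_le_pow_left₀ (norm_nonneg _) this 2
      _ = _ := by rw [mul_pow, Real.sq_sqrt hb]
  -- A negative `b` forces every `p k` and every weighted square to vanish.
  · have h0 : ∀ k, p k = 0 ∧ ∀ i, w i * y k i ^ 2 = 0 := fun k => by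
      have hn : ∀ i ∈ Finset.univ, 0 ≤ w i * y k i ^ 2 :=
        fun i _ => mul_nonneg (hw i) (sq_nonneg _)
      have h1 := Finset.sum_nonneg hn
      have h2 : p k ^ 2 = 0 := by
        refine le_antisymm ?_ (sq_nonneg _)
        by_contra! h3
        linarith [h k, mul_neg_of_neg_of_pos (not_le.1 hb) h3]
      refine ⟨by simpa using h2, fun i => ?_⟩
      have h4 := le_antisymm ((h k).trans (by rw [h2, mul_zero])) h1
      exact (Finset.sum_eq_zero_iff_of_nonneg hn).1 h4 i (Finset.mem_univ i)
    refine (Finset.sum_nonpos fun i _ => ?_).trans (by simp [h0])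
    rcases eq_or_ne (w i) 0 with hi | hi
    · simp [hi]
    · have : ∀ k, y k i = 0 := fun k => by simpa [hi] using (h0 k).2 i
      simp [this]

/-! ### Reduction of mixed states to pure states -/

section Expectation

variable {ι d : Type*} [Fintype ι] [Fintype d]

theorem pureExpectation_smul (r : ℝ) (ψ : EuclideanSpace ℂ d) (A : Matrix d d ℂ) :
    pureExpectation ((r : ℂ) • ψ) A = r ^ 2 * pureExpectation ψ A := by
  have : ∑ a, ∑ b, star (((r : ℂ) • ψ) a) * A a b * ((r : ℂ) • ψ) b =
      ((r ^ 2 : ℝ) : ℂ) * ∑ a, ∑ b, star (ψ a) * A a b * ψ b := by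
    simp only [Finset.mul_sum]
    refine Finset.sum_congr rfl fun a _ => Finset.sum_congr rfl fun b _ => ?_
    simp
    ring
  rw [pureExpectation, this, Complex.re_ofReal_mul, pureExpectation]

/-- `Bᴴ * B` is the sum of the rank-one operators of the conjugated rows of `B`. -/
theorem expectation_conjTranspose_mul_self (B A : Matrix d d ℂ) :
    expectation (Bᴴ * B) A = ∑ k, pureExpectation (WithLp.toLp 2 (star (B k))) A := by
  simp only [expectation, pureExpectation, Matrix.trace, Matrix.diag, Matrix.mul_apply,
    Finset.sum_mul, ← Complex.re_sum]
  congr 1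
  simp only [conjTranspose_apply, Pi.star_apply, star_star]
  calc ∑ x, ∑ y, ∑ i, star (B i x) * B i y * A y x
      = ∑ y, ∑ x, ∑ i, star (B i x) * B i y * A y x := Finset.sum_comm
    _ = ∑ y, ∑ i, ∑ x, star (B i x) * B i y * A y x :=
        Finset.sum_congr rfl fun y _ => Finset.sum_comm
    _ = ∑ i, ∑ y, ∑ x, star (B i x) * B i y * A y x := Finset.sum_comm
    _ = _ := Finset.sum_congr rfl fun i _ => Finset.sum_congr rfl fun y _ =>
        Finset.sum_congr rfl fun x _ => by ring

theorem sum_norm_sq_eq_trace (B : Matrix d d ℂ) :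
    ∑ k, ‖(WithLp.toLp 2 (star (B k)) : EuclideanSpace ℂ d)‖ ^ 2 = (Bᴴ * B).trace.re := by
  simp only [EuclideanSpace.norm_sq_eq, Matrix.trace, Matrix.diag, Matrix.mul_apply,
    Complex.re_sum]
  rw [Finset.sum_comm]
  refine Finset.sum_congr rfl fun a _ => Finset.sum_congr rfl fun k _ => ?_
  rw [conjTranspose_apply, Complex.star_def, ← Complex.normSq_eq_conj_mul_self,
    Complex.ofReal_re, Complex.normSq_eq_norm_sq]
  simp

/-- A bound for pure states extends to all positive semidefinite matrices. -/
theorem sum_mul_expectation_sq_le [DecidableEq d] {w : ι → ℝ} (hw : ∀ i, 0 ≤ w i)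
    {A : ι → Matrix d d ℂ} {b : ℝ}
    (h : ∀ ψ : EuclideanSpace ℂ d, ‖ψ‖ = 1 → ∑ i, w i * pureExpectation ψ (A i) ^ 2 ≤ b)
    {ρ : Matrix d d ℂ} (hρ : ρ.PosSemidef) :
    ∑ i, w i * expectation ρ (A i) ^ 2 ≤ b * ρ.trace.re ^ 2 := by
  obtain ⟨B, rfl⟩ := exists_conjTranspose_mul_self hρ
  simp only [expectation_conjTranspose_mul_self, ← sum_norm_sq_eq_trace]
  -- Minkowski with `p k = ‖ψ_k‖ ^ 2`; each unnormalised vector satisfies the bound by homogeneity.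
  refine sum_mul_sum_sq_le hw (fun k => by positivity) fun k => ?_
  generalize (WithLp.toLp 2 (star (B k)) : EuclideanSpace ℂ d) = ψ
  rcases eq_or_ne ψ 0 with rfl | hψ
  · simp [pureExpectation]
  · have hn : ‖ψ‖ ≠ 0 := norm_ne_zero_iff.2 hψ
    have h1 := h (((‖ψ‖⁻¹ : ℝ) : ℂ) • ψ) (by
      rw [norm_smul, Complex.norm_real, norm_inv, norm_norm, inv_mul_cancel₀ hn])
    have h2 : ∀ i, w i * pureExpectation ψ (A i) ^ 2 = (‖ψ‖ ^ 2) ^ 2 *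
        (w i * pureExpectation (((‖ψ‖⁻¹ : ℝ) : ℂ) • ψ) (A i) ^ 2) := fun i => by
      rw [pureExpectation_smul]
      field_simp
    simp only [h2, ← Finset.mul_sum]
    rw [mul_comm b]
    exact mul_le_mul_of_nonneg_left h1 (by positivity)

theorem isDensityMatrix_vecMulVec {ψ : EuclideanSpace ℂ d} (h : ‖ψ‖ = 1) :
    IsDensityMatrix (vecMulVec (ψ : d → ℂ) (star (ψ : d → ℂ))) := by
  refine ⟨posSemidef_vecMulVec_self_star _, ?_⟩
  have h1 : ∑ a, ‖ψ a‖ ^ 2 = 1 := by rw [← EuclideanSpace.norm_sq_eq, h, one_pow]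
  simp only [Matrix.trace, Matrix.diag, vecMulVec_apply, Pi.star_apply, Complex.star_def,
    Complex.mul_conj, Complex.normSq_eq_norm_sq]
  exact_mod_cast h1

theorem expectation_vecMulVec (ψ : EuclideanSpace ℂ d) (A : Matrix d d ℂ) :
    expectation (vecMulVec (ψ : d → ℂ) (star (ψ : d → ℂ))) A = pureExpectation ψ A := by
  rw [expectation, pureExpectation]
  congr 1
  simp only [Matrix.trace, Matrix.diag, Matrix.mul_apply, vecMulVec_apply, Pi.star_apply]
  rw [Finset.sum_comm]
  exact Finset.sum_congr rfl fun a _ => Finset.sum_congr rfl fun b _ => by ring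

end Expectation

/-! ### Real geometry of Pauli strings acting on a vector -/

section PureStates

variable {d : Type*} [Fintype d]

/-- The space is viewed over ℝ, with the real part of the Hermitian product, because orthonormal
representations are real. -/
theorem inner_mulVec_mulVec (ψ : EuclideanSpace ℂ d) (A B : Matrix d d ℂ) :
    inner ℝ (WithLp.toLp 2 (A *ᵥ ψ) : PiLp 2 fun _ : d => ℂ) (WithLp.toLp 2 (B *ᵥ ψ)) =
      pureExpectation ψ (Aᴴ * B) := by
  simp only [PiLp.inner_apply, Complex.inner, ← Complex.re_sum, pureExpectation]
  congr 1
  simp only [Matrix.mulVec, dotProduct, Matrix.mul_apply, map_sum, map_mul, Finset.sum_mul,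
    Finset.mul_sum, conjTranspose_apply, Complex.star_def]
  calc ∑ x, ∑ a, ∑ b, _ = ∑ a, ∑ x, ∑ b, _ := Finset.sum_comm
    _ = ∑ a, ∑ b, ∑ x, _ := Finset.sum_congr rfl fun a _ => Finset.sum_comm
    _ = _ := Finset.sum_congr rfl fun a _ => Finset.sum_congr rfl fun b _ =>
      Finset.sum_congr rfl fun x _ => by ring

theorem inner_mulVec_self [DecidableEq d] (ψ : EuclideanSpace ℂ d) (A : Matrix d d ℂ) :
    inner ℝ (ψ : PiLp 2 fun _ : d => ℂ) (WithLp.toLp 2 (A *ᵥ ψ)) = pureExpectation ψ A := by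
  simpa using inner_mulVec_mulVec ψ 1 A

theorem norm_mulVec_toMatrix {m : ℕ} (ψ : EuclideanSpace ℂ (Fin m → Fin 2)) (P : PauliString m) :
    ‖(WithLp.toLp 2 (P.toMatrix *ᵥ ψ) : EuclideanSpace ℂ (Fin m → Fin 2))‖ = ‖ψ‖ := by
  have h := inner_mulVec_mulVec ψ P.toMatrix P.toMatrix
  have h1 := inner_mulVec_mulVec ψ 1 1
  rw [(PauliString.isHermitian_toMatrix P).eq, PauliString.toMatrix_mul_self,
    real_inner_self_eq_norm_sq] at h
  rw [conjTranspose_one, one_mul, ← h, one_mulVec, real_inner_self_eq_norm_sq] at h1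
  exact ((sq_eq_sq₀ (norm_nonneg _) (norm_nonneg _)).1 h1).symm

theorem pureExpectation_sq_le_one {m : ℕ} {ψ : EuclideanSpace ℂ (Fin m → Fin 2)} (h : ‖ψ‖ = 1)
    (P : PauliString m) : pureExpectation ψ P.toMatrix ^ 2 ≤ 1 := by
  rw [sq_le_one_iff_abs_le_one, ← inner_mulVec_self]
  refine (abs_real_inner_le_norm _ _).trans ?_
  rw [norm_mulVec_toMatrix, h, one_mul]

/-- Anti-commuting Pauli strings send a vector to orthogonal vectors. -/
theorem inner_mulVec_eq_zero_of_adj {ι : Type*} {m : ℕ} {S : ι → PauliString m} {i j : ι}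
    (h : (frustrationGraph S).Adj i j) (ψ : EuclideanSpace ℂ (Fin m → Fin 2)) :
    inner ℝ (WithLp.toLp 2 ((S i).toMatrix *ᵥ ψ) : PiLp 2 fun _ : Fin m → Fin 2 => ℂ)
      (WithLp.toLp 2 ((S j).toMatrix *ᵥ ψ)) = 0 := by
  have h1 := inner_mulVec_mulVec ψ (S i).toMatrix (S j).toMatrix
  have h2 := inner_mulVec_mulVec ψ (S j).toMatrix (S i).toMatrix
  rw [(PauliString.isHermitian_toMatrix _).eq] at h1 h2
  -- Anti-commutation makes the value antisymmetric in `i, j`, while the real inner product is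
  -- symmetric.
  have h3 : pureExpectation ψ ((S i).toMatrix * (S j).toMatrix) =
      -pureExpectation ψ ((S j).toMatrix * (S i).toMatrix) := by
    rw [h.2, pureExpectation, pureExpectation, ← Complex.neg_re, ← Finset.sum_neg_distrib]
    simp [Finset.sum_neg_distrib]
  rw [real_inner_comm] at h2
  linarith

end PureStates

/-! ### The weighted beta number, attainment of the minimum, and cliques -/

section WeightedBeta

variable {ι : Type*} [Fintype ι] {m : ℕ} {S : ι → PauliString m} {w : ι → ℝ}

theorem sum_mul_pureExpectation_sq_le (S : ι → PauliString m) (hw : ∀ i, 0 ≤ w i)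
    {ψ : EuclideanSpace ℂ (Fin m → Fin 2)} (h : ‖ψ‖ = 1) :
    ∑ i, w i * pureExpectation ψ (S i).toMatrix ^ 2 ≤ ∑ i, w i :=
  Finset.sum_le_sum fun i _ =>
    mul_le_of_le_one_right (hw i) (pureExpectation_sq_le_one h (S i))

instance nonempty_unit_sphere :
    Nonempty (Metric.sphere (0 : EuclideanSpace ℂ (Fin m → Fin 2)) 1) :=
  ⟨⟨EuclideanSpace.single 0 1, by simp⟩⟩

instance nonempty_isDensityMatrix :
    Nonempty {ρ : Matrix (Fin m → Fin 2) (Fin m → Fin 2) ℂ // IsDensityMatrix ρ} :=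
  let ⟨_, h⟩ := nonempty_unit_sphere (m := m)
  ⟨⟨_, isDensityMatrix_vecMulVec (mem_sphere_zero_iff_norm.1 h)⟩⟩

theorem weightedBeta_le (hw : ∀ i, 0 ≤ w i) {b : ℝ}
    (h : ∀ ψ : EuclideanSpace ℂ (Fin m → Fin 2), ‖ψ‖ = 1 →
      ∑ i, w i * pureExpectation ψ (S i).toMatrix ^ 2 ≤ b) : weightedBeta S w ≤ b :=
  ciSup_le fun ρ => by simpa [ρ.2.2] using sum_mul_expectation_sq_le hw h ρ.2.1

theorem le_weightedBeta (hw : ∀ i, 0 ≤ w i) {ρ : Matrix (Fin m → Fin 2) (Fin m → Fin 2) ℂ}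
    (hρ : IsDensityMatrix ρ) :
    ∑ i, w i * expectation ρ (S i).toMatrix ^ 2 ≤ weightedBeta S w := by
  refine le_ciSup (f := fun ρ : {ρ // IsDensityMatrix ρ} =>
    ∑ i, w i * expectation ρ.1 (S i).toMatrix ^ 2) ⟨∑ i, w i, ?_⟩ ⟨ρ, hρ⟩
  rintro _ ⟨ρ, rfl⟩
  simpa [ρ.2.2] using sum_mul_expectation_sq_le hw
    (fun ψ hψ => sum_mul_pureExpectation_sq_le S hw hψ) ρ.2.1

theorem le_weightedBeta_of_pure (hw : ∀ i, 0 ≤ w i) {ψ : EuclideanSpace ℂ (Fin m → Fin 2)}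
    (hψ : ‖ψ‖ = 1) :
    ∑ i, w i * pureExpectation ψ (S i).toMatrix ^ 2 ≤ weightedBeta S w := by
  simpa only [expectation_vecMulVec] using
    le_weightedBeta (S := S) hw (isDensityMatrix_vecMulVec hψ)

theorem bddAbove_pure (S : ι → PauliString m) (hw : ∀ i, 0 ≤ w i) :
    BddAbove (Set.range fun ψ : Metric.sphere (0 : EuclideanSpace ℂ (Fin m → Fin 2)) 1 =>
      ∑ i, w i * pureExpectation ψ.1 (S i).toMatrix ^ 2) :=
  ⟨∑ i, w i, by
    rintro _ ⟨ψ, rfl⟩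
    exact sum_mul_pureExpectation_sq_le S hw (mem_sphere_zero_iff_norm.1 ψ.2)⟩

theorem weightedBeta_eq_iSup_pure (hw : ∀ i, 0 ≤ w i) :
    weightedBeta S w = ⨆ ψ : Metric.sphere (0 : EuclideanSpace ℂ (Fin m → Fin 2)) 1,
      ∑ i, w i * pureExpectation ψ.1 (S i).toMatrix ^ 2 :=
  le_antisymm
    (weightedBeta_le hw fun ψ hψ =>
      le_ciSup (bddAbove_pure S hw) ⟨ψ, mem_sphere_zero_iff_norm.2 hψ⟩)
    (ciSup_le fun ψ => le_weightedBeta_of_pure hw (mem_sphere_zero_iff_norm.1 ψ.2))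

theorem sampleComplexityIndex_eq (S : ι → PauliString m) :
    sampleComplexityIndex S = sInf (weightedBeta S '' stdSimplex ℝ ι) := by
  rw [sInf_image', sampleComplexityIndex]
  exact iInf_congr fun w => (weightedBeta_eq_iSup_pure w.2.1).symm

/-- A supremum of functions continuous in `w` is lower semicontinuous, hence attains its minimum on
the compact simplex. -/
theorem exists_isLeast_weightedBeta [Nonempty ι] (S : ι → PauliString m) :
    ∃ b, IsLeast (weightedBeta S '' stdSimplex ℝ ι) b := by
  classical
  have hlsc : LowerSemicontinuousOn (fun w : ι → ℝ =>
      ⨆ ψ : Metric.sphere (0 : EuclideanSpace ℂ (Fin m → Fin 2)) 1,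
        ∑ i, w i * pureExpectation ψ.1 (S i).toMatrix ^ 2) (stdSimplex ℝ ι) :=
    lowerSemicontinuousOn_ciSup (fun w hw => bddAbove_pure S hw.1) fun ψ =>
      Continuous.lowerSemicontinuous (by fun_prop) |>.lowerSemicontinuousOn _
  obtain ⟨w, hw, hmin⟩ := hlsc.exists_isMinOn
    ⟨_, single_mem_stdSimplex ℝ (Classical.arbitrary ι)⟩ (isCompact_stdSimplex ℝ ι)
  refine ⟨_, ⟨w, hw, rfl⟩, ?_⟩
  rintro _ ⟨w', hw', rfl⟩
  rw [weightedBeta_eq_iSup_pure hw.1, weightedBeta_eq_iSup_pure hw'.1]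
  exact hmin hw'

theorem isLeast_sampleComplexityIndex [Nonempty ι] (S : ι → PauliString m) :
    IsLeast (weightedBeta S '' stdSimplex ℝ ι) (sampleComplexityIndex S) := by
  obtain ⟨b, hb⟩ := exists_isLeast_weightedBeta S
  rwa [sampleComplexityIndex_eq, hb.csInf_eq]

theorem sum_le_weightedBeta_of_isClique (hw : ∀ i, 0 ≤ w i) {C : Finset ι}
    (hC : (frustrationGraph S)ᶜ.IsClique (C : Set ι)) : ∑ i ∈ C, w i ≤ weightedBeta S w := by
  have hcomm : ∀ i ∈ C, ∀ j ∈ C, Commute (S i).toMatrix (S j).toMatrix := fun i hi j hj => by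
    rcases eq_or_ne i j with rfl | hij
    · exact Commute.refl _
    · exact commute_of_not_adj ((SimpleGraph.compl_adj _ _ _).1 (hC hi hj hij)).2
  obtain ⟨K, _, P, σ, hP, hsum, hσ, hTP⟩ := exists_joint_projections
    (fun i => (S i).toMatrix) C (fun i _ => (S i).isHermitian_toMatrix)
    (fun i _ => (S i).toMatrix_mul_self) hcomm
  -- Normalising a nonzero joint projection gives a state with `⟨S i⟩ = ±1` for all `i ∈ C`.
  obtain ⟨k, hk⟩ : ∃ k, P k ≠ 0 := by
    by_contra! h
    simp [h] at hsum
  have htr : (P k).trace ≠ 0 := fun h => hk ((hP k).trace_eq_zero_iff.1 h)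
  have hpos := (hP k).trace_nonneg
  have hρ : IsDensityMatrix ((P k).trace⁻¹ • P k) :=
    ⟨(hP k).smul (inv_nonneg.2 hpos), by rw [trace_smul, smul_eq_mul, inv_mul_cancel₀ htr]⟩
  refine le_trans ?_ (le_weightedBeta hw hρ)
  calc ∑ i ∈ C, w i
      = ∑ i ∈ C, w i * expectation ((P k).trace⁻¹ • P k) (S i).toMatrix ^ 2 := by
        refine Finset.sum_congr rfl fun i hi => ?_
        rw [expectation, Matrix.trace_mul_comm, mul_smul_comm, hTP k i hi, smul_comm, trace_smul,
          trace_smul, smul_eq_mul, smul_eq_mul, inv_mul_cancel₀ htr]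
        rcases hσ k i with h | h <;> simp [h]
    _ ≤ _ := Finset.sum_le_sum_of_subset_of_nonneg (Finset.subset_univ C) fun i _ _ =>
        mul_nonneg (hw i) (sq_nonneg _)

end WeightedBeta

/-! ### Independence of the realization -/

section Realization

/-- The partial trace over the first tensor factor. -/
def partialTraceLeft {d d' : Type*} [Fintype d'] (R : Matrix (d' × d) (d' × d) ℂ) :
    Matrix d d ℂ :=
  ∑ a, R.submatrix (Prod.mk a) (Prod.mk a)

theorem posSemidef_partialTraceLeft {d d' : Type*} [Fintype d']
    {R : Matrix (d' × d) (d' × d) ℂ} (h : R.PosSemidef) :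
    (partialTraceLeft R).PosSemidef :=
  posSemidef_sum _ fun _ _ => h.submatrix _

theorem trace_partialTraceLeft_mul {d d' : Type*} [Fintype d] [Fintype d'] [DecidableEq d']
    (R : Matrix (d' × d) (d' × d) ℂ) (X : Matrix d d ℂ) :
    (partialTraceLeft R * X).trace = (R * ((1 : Matrix d' d' ℂ) ⊗ₖ X)).trace := by
  rw [partialTraceLeft, Finset.sum_mul, Matrix.trace_sum]
  simp [Matrix.trace, Matrix.mul_apply, Fintype.sum_prod_type, Matrix.one_apply]

variable {d d' : Type*} [Fintype d] [Fintype d'] [DecidableEq d] [DecidableEq d']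

/-- For `ρ = Bᴴ * B` this represents `X ↦ tr ((ρ ⊗ X) P)` by an operator that is visibly positive
when `P` is. -/
theorem trace_partialTraceLeft_sandwich (B : Matrix d' d' ℂ) (P : Matrix (d' × d) (d' × d) ℂ)
    (X : Matrix d d ℂ) :
    (partialTraceLeft ((B ⊗ₖ (1 : Matrix d d ℂ)) * P * (B ⊗ₖ (1 : Matrix d d ℂ))ᴴ) * X).trace =
      (((Bᴴ * B) ⊗ₖ X) * P).trace := by
  rw [trace_partialTraceLeft_mul, mul_assoc, mul_assoc, Matrix.trace_mul_comm, mul_assoc,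
    Matrix.trace_mul_comm, conjTranspose_kronecker, conjTranspose_one, ← mul_kronecker_mul,
    ← mul_kronecker_mul, one_mul, mul_one, mul_one]

/-- If the operators `A i ⊗ B i` are pairwise commuting involutions, then the expectation values of
the `A i` in any state are, up to signs, mixtures of expectation values of the `B i`. -/
theorem exists_states_of_commute_kronecker {ι : Type*} [Fintype ι] {A : ι → Matrix d' d' ℂ}
    {B : ι → Matrix d d ℂ} (hA : ∀ i, (A i).IsHermitian) (hB : ∀ i, (B i).IsHermitian)
    (hAA : ∀ i, A i * A i = 1) (hBB : ∀ i, B i * B i = 1)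
    (hcomm : ∀ i j, Commute (A i ⊗ₖ B i) (A j ⊗ₖ B j)) {ρ : Matrix d' d' ℂ}
    (hρ : IsDensityMatrix ρ) :
    ∃ (K : Type) (_ : Fintype K) (τ : K → Matrix d d ℂ) (σ : K → ι → ℝ),
      (∀ k, (τ k).PosSemidef) ∧ (∀ k, ∀ i, σ k i = 1 ∨ σ k i = -1) ∧
      ∑ k, (τ k).trace.re = Fintype.card d ∧
      ∀ i, ∑ k, σ k i * expectation (τ k) (B i) = Fintype.card d * expectation ρ (A i) := by
  obtain ⟨K, hK, P, σ, hP, hsum, hσ, hTP⟩ := exists_joint_projections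
    (fun i => A i ⊗ₖ B i) Finset.univ
    (fun i _ => by rw [IsHermitian, conjTranspose_kronecker, (hA i).eq, (hB i).eq])
    (fun i _ => by rw [← mul_kronecker_mul, hAA, hBB, one_kronecker_one])
    (fun i _ j _ => hcomm i j)
  obtain ⟨C, hC⟩ := exists_conjTranspose_mul_self hρ.1
  refine ⟨K, hK, fun k => partialTraceLeft ((C ⊗ₖ (1 : Matrix d d ℂ)) * P k *
    (C ⊗ₖ (1 : Matrix d d ℂ))ᴴ), σ,
    fun k => posSemidef_partialTraceLeft ((hP k).mul_mul_conjTranspose_same _), hσ, ?_, fun i => ?_⟩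
  · have h : ∀ k, (partialTraceLeft ((C ⊗ₖ (1 : Matrix d d ℂ)) * P k *
        (C ⊗ₖ (1 : Matrix d d ℂ))ᴴ)).trace = ((ρ ⊗ₖ (1 : Matrix d d ℂ)) * P k).trace := fun k => by
      rw [hC, ← trace_partialTraceLeft_sandwich, mul_one]
    simp only [h, ← Complex.re_sum, ← Matrix.trace_sum, ← Finset.mul_sum, hsum, mul_one]
    simp [trace_kronecker, hρ.2]
  · have h : ∀ k, σ k i * expectation (partialTraceLeft ((C ⊗ₖ (1 : Matrix d d ℂ)) * P k *
        (C ⊗ₖ (1 : Matrix d d ℂ))ᴴ)) (B i) =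
        (((ρ * A i) ⊗ₖ (1 : Matrix d d ℂ)) * P k).trace.re := fun k => by
      have hs : (σ k i : ℂ) * σ k i = 1 := by rcases hσ k i with h | h <;> simp [h]
      -- `A i` squares to 1, so `ρ ⊗ B i = (ρ A i ⊗ 1)(A i ⊗ B i)`, and the last factor acts on `P
      -- k` as the sign.
      have h1 : (ρ ⊗ₖ B i) * P k = (σ k i : ℂ) • (((ρ * A i) ⊗ₖ (1 : Matrix d d ℂ)) * P k) := by
        rw [← mul_smul_comm, ← hTP k i (Finset.mem_univ i), ← mul_assoc, ← mul_kronecker_mul,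
          mul_assoc, hAA, mul_one, one_mul]
      rw [expectation, trace_partialTraceLeft_sandwich, ← hC, h1, trace_smul, smul_eq_mul,
        ← Complex.re_ofReal_mul, ← mul_assoc, hs, one_mul]
    simp only [h, ← Complex.re_sum, ← Matrix.trace_sum, ← Finset.mul_sum, hsum, mul_one]
    simp [trace_kronecker, expectation, mul_comm]

/-- The two factors commute or anti-commute together, so the signs cancel. -/
theorem commute_kronecker_of_frustrationGraph_eq {ι : Type*} {m m' : ℕ} {S : ι → PauliString m}
    {S' : ι → PauliString m'} (h : frustrationGraph S' = frustrationGraph S) (i j : ι) :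
    Commute ((S' i).toMatrix ⊗ₖ (S i).toMatrix) ((S' j).toMatrix ⊗ₖ (S j).toMatrix) := by
  rw [Commute, SemiconjBy, ← mul_kronecker_mul, ← mul_kronecker_mul]
  by_cases hij : (frustrationGraph S).Adj i j
  · rw [hij.2, (h ▸ hij : (frustrationGraph S').Adj i j).2]
    ext a b
    simp
  · rw [(commute_of_not_adj hij).eq, (commute_of_not_adj (h ▸ hij)).eq]

/-- The weighted beta number depends only on the frustration graph and the weights. -/
theorem sum_mul_expectation_sq_le_weightedBeta {ι : Type*} [Fintype ι] {m m' : ℕ}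
    {S : ι → PauliString m} {S' : ι → PauliString m'}
    (h : frustrationGraph S' = frustrationGraph S) {w : ι → ℝ} (hw : ∀ i, 0 ≤ w i)
    {ρ : Matrix (Fin m' → Fin 2) (Fin m' → Fin 2) ℂ} (hρ : IsDensityMatrix ρ) :
    ∑ i, w i * expectation ρ (S' i).toMatrix ^ 2 ≤ weightedBeta S w := by
  obtain ⟨K, _, τ, σ, hτ, hσ, htr, hexp⟩ := exists_states_of_commute_kronecker
    (fun i => (S' i).isHermitian_toMatrix) (fun i => (S i).isHermitian_toMatrix)
    (fun i => (S' i).toMatrix_mul_self) (fun i => (S i).toMatrix_mul_self)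
    (commute_kronecker_of_frustrationGraph_eq h) hρ
  -- The signs disappear on squaring; both sides carry the squared dimension, which is cancelled
  -- below.
  have key := sum_mul_sum_sq_le hw (b := weightedBeta S w) (p := fun k => (τ k).trace.re)
    (y := fun k i => σ k i * expectation (τ k) (S i).toMatrix)
    (fun k => (Complex.le_def.1 (hτ k).trace_nonneg).1) fun k => by
      have hs : ∀ i, σ k i ^ 2 = 1 := fun i => by rcases hσ k i with h | h <;> simp [h]
      simp only [mul_pow, hs, one_mul]
      exact sum_mul_expectation_sq_le hw (fun ψ hψ => le_weightedBeta_of_pure hw hψ) (hτ k)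
  simp only [htr, hexp] at key
  have hD : (0 : ℝ) < (Fintype.card (Fin m → Fin 2) : ℝ) ^ 2 := by positivity
  refine le_of_mul_le_mul_right (le_of_eq_of_le ?_ key) hD
  rw [Finset.sum_mul]
  exact Finset.sum_congr rfl fun i _ => by ring

theorem weightedBeta_eq_of_frustrationGraph_eq {ι : Type*} [Fintype ι] {m m' : ℕ}
    {S : ι → PauliString m} {S' : ι → PauliString m'}
    (h : frustrationGraph S' = frustrationGraph S) {w : ι → ℝ} (hw : ∀ i, 0 ≤ w i) :
    weightedBeta S' w = weightedBeta S w :=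
  le_antisymm (ciSup_le fun ρ => sum_mul_expectation_sq_le_weightedBeta h hw ρ.2)
    (ciSup_le fun ρ => sum_mul_expectation_sq_le_weightedBeta h.symm hw ρ.2)

end Realization

/-! ### Minimax by separation -/

/-- A form of the minimax theorem: if no point of a convex set exceeds `t` in all coordinates, then
some probability vector has weighted average at most `t` on the whole set. -/
theorem exists_mem_stdSimplex_sum_mul_le {ι : Type*} [Fintype ι] {Q : Set (ι → ℝ)}
    (hQ : Convex ℝ Q) (hne : Q.Nonempty)
    {t : ℝ} (h : ∀ x ∈ Q, ∃ i, x i ≤ t) :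
    ∃ w ∈ stdSimplex ℝ ι, ∀ x ∈ Q, ∑ i, w i * x i ≤ t := by
  classical
  let O : Set (ι → ℝ) := Set.univ.pi fun _ => Set.Ioi t
  have hO : IsOpen O := isOpen_set_pi Set.finite_univ fun _ _ => isOpen_Ioi
  have hOc : Convex ℝ O := convex_pi fun _ _ => convex_Ioi t
  have hdisj : Disjoint Q O := Set.disjoint_left.2 fun x hx hxO => by
    obtain ⟨i, hi⟩ := h x hx
    exact not_lt.2 hi (hxO i trivial)
  obtain ⟨f, s, hfO, hfQ⟩ := geometric_hahn_banach_open hOc hO hQ hdisj.symm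
  -- The separating functional is small on the orthant `O` and large on `Q`; negating it makes its
  -- coefficients the weights.
  let g : ι → ℝ := fun i => -f (Pi.single i 1)
  have hg : ∀ x, ∑ i, g i * x i = -f x := fun x => by
    conv_rhs => rw [pi_eq_sum_univ' x]
    simp [g, map_sum, mul_comm, Finset.sum_neg_distrib]
  have hgO : ∀ x : ι → ℝ, (∀ i, t < x i) → -s < ∑ i, g i * x i := fun x hx => by
    rw [hg]
    exact neg_lt_neg (hfO x fun i _ => hx i)
  have hgQ : ∀ x ∈ Q, ∑ i, g i * x i ≤ -s := fun x hx => by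
    rw [hg]
    exact neg_le_neg (hfQ x hx)
  have hg0 : ∀ i, 0 ≤ g i := fun i => by
    by_contra! hi
    have h1 : -s < ∑ j, g j * (t + 1) := hgO (fun _ => t + 1) fun _ => by linarith
    -- Were `g i` negative, moving this far along coordinate `i` inside `O` would bring the
    -- functional down to exactly `-s`.
    set M := ((∑ j, g j * (t + 1)) + s) / -g i with hM
    have hMpos : 0 ≤ M := div_nonneg (by linarith) (by linarith)
    have h2 := hgO (fun j => t + 1 + Pi.single (M := fun _ => ℝ) i M j) fun j => by
      rcases eq_or_ne j i with rfl | hj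
      · simp only [Pi.single_eq_same]
        linarith
      · simp [hj]
    have h3 : g i * M = -((∑ j, g j * (t + 1)) + s) := by
      rw [hM, div_neg, mul_neg, mul_div_cancel₀ _ hi.ne]
    simp only [mul_add, Finset.sum_add_distrib] at h2 h3
    simp only [Pi.single_apply, mul_ite, mul_zero, Finset.sum_ite_eq', Finset.mem_univ,
      if_true] at h2
    linarith
  have hpos : 0 < ∑ i, g i := by
    refine (Finset.sum_nonneg fun i _ => hg0 i).lt_of_ne' fun h0 => ?_
    have hz : ∀ i, g i = 0 := fun i =>
      (Finset.sum_eq_zero_iff_of_nonneg fun i _ => hg0 i).1 h0 i (Finset.mem_univ i)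
    obtain ⟨x, hx⟩ := hne
    have h1 := hgQ x hx
    have h2 := hgO (fun _ => t + 1) fun _ => by linarith
    simp only [hz, zero_mul, Finset.sum_const_zero] at h1 h2
    linarith
  have hs : -s ≤ t * ∑ i, g i := by
    refine le_of_forall_pos_le_add fun ε hε => ?_
    -- The corner `(t, …, t)` of `O` is approached from inside.
    have h1 := hgO (fun _ => t + ε / ∑ i, g i) fun _ => by
      linarith [div_pos hε hpos]
    rw [← Finset.sum_mul, mul_add, mul_div_cancel₀ _ hpos.ne'] at h1
    linarith
  refine ⟨fun i => g i / ∑ j, g j, ⟨fun i => div_nonneg (hg0 i) hpos.le, ?_⟩, fun x hx => ?_⟩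
  · rw [← Finset.sum_div, div_self hpos.ne']
  · simp only [div_mul_eq_mul_div, ← Finset.sum_div]
    rw [div_le_iff₀ hpos]
    exact (hgQ x hx).trans hs

/-! ### Fractional packing and ħ-perfect graphs -/

section FractionalPacking

variable {ι : Type*} [Fintype ι]

theorem bddAbove_fractionalPacking (G : SimpleGraph ι) :
    BddAbove {t | ∃ w : ι → ℝ, (∀ i, 0 ≤ w i) ∧
      (∀ C : Finset ι, G.IsClique (C : Set ι) → ∑ i ∈ C, w i ≤ 1) ∧ t = ∑ i, w i} := by
  refine ⟨∑ _i : ι, 1, ?_⟩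
  rintro _ ⟨w, -, hC, rfl⟩
  exact Finset.sum_le_sum fun i _ => by simpa using hC {i} (by simp)

theorem sum_le_fractionalPackingNumber {G : SimpleGraph ι} {w : ι → ℝ} (hw : ∀ i, 0 ≤ w i)
    (hC : ∀ C : Finset ι, G.IsClique (C : Set ι) → ∑ i ∈ C, w i ≤ 1) :
    ∑ i, w i ≤ fractionalPackingNumber G :=
  le_csSup (bddAbove_fractionalPacking G) ⟨w, hw, hC, rfl⟩

theorem one_le_fractionalPackingNumber [Nonempty ι] (G : SimpleGraph ι) :
    1 ≤ fractionalPackingNumber G := by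
  classical
  let i₀ := Classical.arbitrary ι
  have h := sum_le_fractionalPackingNumber (G := G) (w := Pi.single i₀ 1)
    (fun i => by rcases eq_or_ne i i₀ with rfl | h <;> simp [*])
    (fun C _ => (Finset.sum_le_sum_of_subset_of_nonneg (Finset.subset_univ C) fun i _ _ => by
      rcases eq_or_ne i i₀ with rfl | h <;> simp [*]).trans (by simp))
  simpa using h

variable {m : ℕ} {S : ι → PauliString m} {w : ι → ℝ}

theorem one_div_fractionalPackingNumber_le_weightedBeta [Nonempty ι] (hw : w ∈ stdSimplex ℝ ι) :
    1 / fractionalPackingNumber (frustrationGraph S)ᶜ ≤ weightedBeta S w := by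
  -- A singleton clique with positive weight suffices.
  have hβ : 0 < weightedBeta S w := by
    obtain ⟨i, -, hi⟩ := Finset.exists_ne_zero_of_sum_ne_zero
      (show ∑ i, w i ≠ 0 by rw [hw.2]; exact one_ne_zero)
    refine lt_of_lt_of_le ((hw.1 i).lt_of_ne' hi) ?_
    simpa using sum_le_weightedBeta_of_isClique (S := S) hw.1 (C := {i}) (by simp)
  have h := sum_le_fractionalPackingNumber (G := (frustrationGraph S)ᶜ)
    (w := fun i => w i / weightedBeta S w) (fun i => div_nonneg (hw.1 i) hβ.le) fun C hC => by
      rw [← Finset.sum_div, div_le_one hβ]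
      exact sum_le_weightedBeta_of_isClique hw.1 hC
  rw [← Finset.sum_div, hw.2] at h
  exact one_div_le (zero_lt_one.trans_le (one_le_fractionalPackingNumber _)) hβ |>.2 h

/-- The support of a stable 0-1 vector is a clique of the complement, so the inequality holds at the
generators of the hull. -/
theorem sum_mul_le_one_of_mem_stableSetPolytope {G : SimpleGraph ι}
    (hC : ∀ C : Finset ι, Gᶜ.IsClique (C : Set ι) → ∑ i ∈ C, w i ≤ 1) {x : ι → ℝ}
    (hx : x ∈ stableSetPolytope G) : ∑ i, w i * x i ≤ 1 := by
  classical
  have hconv : Convex ℝ {x : ι → ℝ | ∑ i, w i * x i ≤ 1} :=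
    convex_halfSpace_le ⟨fun x y => by simp [mul_add, Finset.sum_add_distrib],
      fun c x => by simp [Finset.mul_sum, mul_left_comm]⟩ 1
  refine convexHull_min ?_ hconv hx
  rintro v ⟨h01, hadj⟩
  have h := hC (Finset.univ.filter fun i => v i = 1) fun i hi j hj hij => by
    simp only [Finset.coe_filter, Finset.mem_univ, true_and, Set.mem_ofPred_eq] at hi hj
    refine (SimpleGraph.compl_adj _ _ _).2 ⟨hij, fun h => ?_⟩
    simpa [hi, hj] using hadj i j h
  refine le_of_eq_of_le ?_ h
  rw [Finset.sum_filter]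
  refine Finset.sum_congr rfl fun i _ => ?_
  rcases h01 i with h | h <;> simp [h]

theorem weightedBeta_le_one_of_isHbarPerfect (hG : IsHbarPerfect (frustrationGraph S))
    (hw : ∀ i, 0 ≤ w i)
    (hC : ∀ C : Finset ι, (frustrationGraph S)ᶜ.IsClique (C : Set ι) → ∑ i ∈ C, w i ≤ 1) :
    weightedBeta S w ≤ 1 := by
  obtain ⟨m', S', hS, hB⟩ := hG
  rw [← weightedBeta_eq_of_frustrationGraph_eq hS hw]
  refine ciSup_le fun ρ => sum_mul_le_one_of_mem_stableSetPolytope hC ?_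
  rw [hB]
  exact ⟨subset_convexHull ℝ _ (subset_lowerClosure ⟨ρ.1, ρ.2, fun i => rfl⟩),
    fun i => sq_nonneg _⟩

theorem weightedBeta_smul {r : ℝ} (hr : 0 ≤ r) (S : ι → PauliString m) (w : ι → ℝ) :
    weightedBeta S (r • w) = r * weightedBeta S w := by
  rw [weightedBeta, weightedBeta, Real.mul_iSup_of_nonneg hr]
  simp [Finset.mul_sum, mul_assoc]

theorem sampleComplexityIndex_le [Nonempty ι] (hw : w ∈ stdSimplex ℝ ι) :
    sampleComplexityIndex S ≤ weightedBeta S w :=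
  (isLeast_sampleComplexityIndex S).2 ⟨w, hw, rfl⟩

theorem one_div_fractionalPackingNumber_le [Nonempty ι] (S : ι → PauliString m) :
    1 / fractionalPackingNumber (frustrationGraph S)ᶜ ≤ sampleComplexityIndex S := by
  obtain ⟨w, hw, h⟩ := (isLeast_sampleComplexityIndex S).1
  exact h ▸ one_div_fractionalPackingNumber_le_weightedBeta hw

theorem sampleComplexityIndex_le_of_isHbarPerfect [Nonempty ι]
    (hG : IsHbarPerfect (frustrationGraph S)) :
    sampleComplexityIndex S ≤ 1 / fractionalPackingNumber (frustrationGraph S)ᶜ := by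
  have hα := zero_lt_one.trans_le (one_le_fractionalPackingNumber (frustrationGraph S)ᶜ)
  have hδ := (one_div_pos.2 hα).trans_le (one_div_fractionalPackingNumber_le S)
  rw [le_one_div hδ hα]
  refine Real.sSup_le ?_ (by positivity)
  rintro _ ⟨w, hw, hC, rfl⟩
  -- Zero total weight cannot be normalised and is settled separately.
  rcases (Finset.sum_nonneg fun i _ => hw i).eq_or_lt with h0 | h0
  · rw [← h0]
    positivity
  rw [le_one_div h0 hδ]
  have hmem : (∑ i, w i)⁻¹ • w ∈ stdSimplex ℝ ι :=
    ⟨fun i => mul_nonneg (inv_nonneg.2 h0.le) (hw i), by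
      simp [← Finset.mul_sum, inv_mul_cancel₀ h0.ne']⟩
  refine (sampleComplexityIndex_le hmem).trans ?_
  rw [weightedBeta_smul (inv_nonneg.2 h0.le), one_div]
  exact mul_le_of_le_one_right (inv_nonneg.2 h0.le)
    (weightedBeta_le_one_of_isHbarPerfect hG hw hC)

end FractionalPacking

/-! ### Lovász number -/

section Lovasz

variable {ι : Type*}

/-- Cauchy–Schwarz. It bounds the set defining `lovaszNumber` below and keeps its infimum away from
0. -/
theorem one_le_lovasz_value [Finite ι] [Nonempty ι] {d : ℕ} {u : ι → EuclideanSpace ℝ (Fin d)}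
    {c : EuclideanSpace ℝ (Fin d)} (hu : ∀ i, ‖u i‖ = 1) (hc : ‖c‖ = 1)
    (h0 : ∀ i, inner ℝ c (u i) ≠ 0) : 1 ≤ ⨆ i, 1 / inner ℝ c (u i) ^ 2 := by
  refine le_trans ?_ (le_ciSup (Set.finite_range _).bddAbove (Classical.arbitrary ι))
  rw [le_div_iff₀ (by positivity [h0 (Classical.arbitrary ι)]), one_mul, sq_le_one_iff_abs_le_one]
  simpa [hu, hc] using abs_real_inner_le_norm c (u (Classical.arbitrary ι))

/-- An orthonormal representation in any Euclidean space bounds the Lovász number from above. -/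
theorem lovaszNumber_le_of_representation [Finite ι] [Nonempty ι] {G : SimpleGraph ι} {E : Type*}
    [NormedAddCommGroup E] [InnerProductSpace ℝ E] [FiniteDimensional ℝ E] {u : ι → E} {c : E}
    (hu : ∀ i, ‖u i‖ = 1) (hperp : ∀ i j, i ≠ j → ¬ G.Adj i j → inner ℝ (u i) (u j) = 0)
    (hc : ‖c‖ = 1) {t : ℝ} (ht : 0 < t) (h : ∀ i, t ≤ inner ℝ c (u i) ^ 2) :
    1 ≤ lovaszNumber G ∧ lovaszNumber G ≤ 1 / t := by
  let e := (stdOrthonormalBasis ℝ E).repr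
  have hne : ∀ i, inner ℝ (e c) (e (u i)) ≠ 0 := fun i h0 => by
    rw [e.inner_map_map] at h0
    linarith [h i, show inner ℝ c (u i) ^ 2 = 0 by rw [h0]; ring]
  have hrep : (⨆ i, 1 / inner ℝ (e c) (e (u i)) ^ 2) ∈
      {t | ∃ (d : ℕ) (u : ι → EuclideanSpace ℝ (Fin d)) (c : EuclideanSpace ℝ (Fin d)),
        IsOrthonormalRepresentation G u ∧ ‖c‖ = 1 ∧ (∀ i, inner ℝ c (u i) ≠ 0) ∧
        t = ⨆ i, 1 / inner ℝ c (u i) ^ 2} :=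
    ⟨_, fun i => e (u i), e c, ⟨fun i => by rw [e.norm_map, hu], fun i j hij hadj => by
      rw [e.inner_map_map, hperp i j hij hadj]⟩, by rw [e.norm_map, hc], hne, rfl⟩
  have hlb : (1 : ℝ) ∈ lowerBounds
      {t | ∃ (d : ℕ) (u : ι → EuclideanSpace ℝ (Fin d)) (c : EuclideanSpace ℝ (Fin d)),
        IsOrthonormalRepresentation G u ∧ ‖c‖ = 1 ∧ (∀ i, inner ℝ c (u i) ≠ 0) ∧
        t = ⨆ i, 1 / inner ℝ c (u i) ^ 2} := by
    rintro _ ⟨d, u, c, hu, hc, h0, rfl⟩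
    exact one_le_lovasz_value hu.1 hc h0
  refine ⟨le_csInf ⟨_, hrep⟩ hlb, (csInf_le ⟨1, hlb⟩ hrep).trans (ciSup_le fun i => ?_)⟩
  rw [e.inner_map_map]
  exact one_div_le_one_div_of_le ht (h i)

variable [Fintype ι] [Nonempty ι] {m : ℕ} {S : ι → PauliString m}

/-- The tuples `(⟨ψ| S i |ψ⟩ ^ 2)_i` for unit vectors `ψ`. -/
def pureVarianceRange {ι : Type*} {m : ℕ} (S : ι → PauliString m) : Set (ι → ℝ) :=
  {q | ∃ ψ : EuclideanSpace ℂ (Fin m → Fin 2), ‖ψ‖ = 1 ∧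
    q = fun i => pureExpectation ψ (S i).toMatrix ^ 2}

/-- A mixture of pure variance tuples is bounded by the Lovász number of the complement. -/
theorem le_one_div_lovaszNumber {x : ι → ℝ} (hx : x ∈ convexHull ℝ (pureVarianceRange S)) {t : ℝ}
    (ht : 0 < t) (h : ∀ i, t ≤ x i) : t ≤ 1 / lovaszNumber (frustrationGraph S)ᶜ := by
  obtain ⟨K, _, p, z, hp, hp1, hz, rfl⟩ := mem_convexHull_iff_exists_fintype.1 hx
  choose ψ hψ hzψ using hz
  set x := ∑ k, p k • z k with hxdef
  have hxi : ∀ i, ∑ k, p k * pureExpectation (ψ k) (S i).toMatrix ^ 2 = x i := fun i => by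
    simp [hxdef, hzψ]
  have hxpos : ∀ i, 0 < x i := fun i => ht.trans_le (h i)
  let E := PiLp 2 fun _ : Fin m → Fin 2 => ℂ
  let v : K → ι → E := fun k i => WithLp.toLp 2 ((S i).toMatrix *ᵥ ψ k)
  have hv : ∀ k i, ‖v k i‖ = 1 := fun k i => (norm_mulVec_toMatrix _ _).trans (hψ k)
  -- The representation is a direct sum over the mixture: block `k` of `c` is `√p_k ψ_k`, that of `u
  -- i` is a multiple of `S i ψ_k`. These coefficients make `u i` a unit vector with `⟨c, u i⟩ = √(x
  -- i)`.
  let r : K → ι → ℝ := fun k i => √(p k) * pureExpectation (ψ k) (S i).toMatrix / √(x i)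
  let c : PiLp 2 fun _ : K => E := WithLp.toLp 2 fun k => √(p k) • (ψ k : E)
  let u : ι → PiLp 2 fun _ : K => E := fun i => WithLp.toLp 2 fun k => r k i • v k i
  have hcu : ∀ i, inner ℝ c (u i) ^ 2 = x i := fun i => by
    have : inner ℝ c (u i) = x i / √(x i) := by
      rw [← hxi, Finset.sum_div, PiLp.inner_apply]
      refine Finset.sum_congr rfl fun k _ => ?_
      simp only [c, u, r, real_inner_smul_left, real_inner_smul_right, v]
      rw [inner_mulVec_self, hxi]
      calc _ = √(p k) * √(p k) * pureExpectation (ψ k) (S i).toMatrix ^ 2 / √(x i) := by ring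
        _ = _ := by rw [Real.mul_self_sqrt (hp k)]
    rw [this, Real.div_sqrt, Real.sq_sqrt (hxpos i).le]
  have hu : ∀ i, ‖u i‖ = 1 := fun i => by
    have : ‖u i‖ ^ 2 = 1 := by
      rw [PiLp.norm_sq_eq_of_L2]
      simp only [u, norm_smul, hv, mul_one, r, Real.norm_eq_abs, sq_abs, div_pow, mul_pow,
        Real.sq_sqrt (hp _), Real.sq_sqrt (hxpos _).le]
      rw [← Finset.sum_div, hxi, div_self (hxpos i).ne']
    exact (pow_eq_one_iff_of_nonneg (norm_nonneg _) two_ne_zero).1 this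
  have hc : ‖c‖ = 1 := by
    have : ‖c‖ ^ 2 = 1 := by
      rw [PiLp.norm_sq_eq_of_L2, ← hp1]
      refine Finset.sum_congr rfl fun k _ => ?_
      simp only [c, norm_smul, mul_pow, Real.norm_eq_abs, sq_abs, Real.sq_sqrt (hp _)]
      rw [show ‖(ψ k : E)‖ = 1 from hψ k, one_pow, mul_one]
    exact (pow_eq_one_iff_of_nonneg (norm_nonneg _) two_ne_zero).1 this
  have hperp : ∀ i j, i ≠ j → ¬ (frustrationGraph S)ᶜ.Adj i j → inner ℝ (u i) (u j) = 0 := by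
    intro i j hij hadj
    have hadj' : (frustrationGraph S).Adj i j := by
      by_contra hn
      exact hadj ((SimpleGraph.compl_adj _ _ _).2 ⟨hij, hn⟩)
    rw [PiLp.inner_apply]
    refine Finset.sum_eq_zero fun k _ => ?_
    simp only [u, v, real_inner_smul_left, real_inner_smul_right]
    rw [inner_mulVec_eq_zero_of_adj hadj', mul_zero, mul_zero]
  obtain ⟨h1, h2⟩ := lovaszNumber_le_of_representation hu hperp hc ht
    fun i => (h i).trans_eq (hcu i).symm
  exact (le_one_div ht (zero_lt_one.trans_le h1)).2 h2

/-- Even with the conventions `sInf ∅ = 0` and `1 / 0 = 0`, this keeps `1 / ϑ` nonnegative. -/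
theorem lovaszNumber_nonneg {ι : Type*} (G : SimpleGraph ι) : 0 ≤ lovaszNumber G := by
  refine Real.sInf_nonneg ?_
  rintro _ ⟨d, u, c, -, -, -, rfl⟩
  exact Real.iSup_nonneg fun i => by positivity

theorem sampleComplexityIndex_le_one_div_lovaszNumber (S : ι → PauliString m) :
    sampleComplexityIndex S ≤ 1 / lovaszNumber (frustrationGraph S)ᶜ := by
  obtain ⟨⟨ψ, hψ⟩⟩ := nonempty_unit_sphere (m := m)
  obtain ⟨w, hw, h⟩ := exists_mem_stdSimplex_sum_mul_le
    (convex_convexHull ℝ (pureVarianceRange S))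
    ⟨_, subset_convexHull ℝ _ ⟨ψ, mem_sphere_zero_iff_norm.1 hψ, rfl⟩⟩
    (t := 1 / lovaszNumber (frustrationGraph S)ᶜ) fun x hx => by
      by_contra! hlt
      -- The smallest coordinate serves as the level `t` in `le_one_div_lovaszNumber`.
      obtain ⟨i, hi⟩ := Finite.exists_min x
      have hpos : 0 < x i := (div_nonneg zero_le_one (lovaszNumber_nonneg _)).trans_lt (hlt i)
      exact not_lt.2 (le_one_div_lovaszNumber hx hpos hi) (hlt i)
  exact (sampleComplexityIndex_le hw).trans
    (weightedBeta_le hw.1 fun ψ hψ => h _ (subset_convexHull ℝ _ ⟨ψ, hψ, rfl⟩))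

end Lovasz

end PauliShadow

theorem theorem5 {ι : Type*} [Fintype ι] [Nonempty ι] {m : ℕ} (S : ι → PauliString m) :
    IsLeast (weightedBeta S '' stdSimplex ℝ ι) (sampleComplexityIndex S) ∧
    sampleComplexityIndex S ∈
      Set.Icc (1 / fractionalPackingNumber (frustrationGraph S)ᶜ)
        (1 / lovaszNumber (frustrationGraph S)ᶜ) ∧
    (IsHbarPerfect (frustrationGraph S) →
      sampleComplexityIndex S = 1 / fractionalPackingNumber (frustrationGraph S)ᶜ) :=
  ⟨isLeast_sampleComplexityIndex S,
    ⟨one_div_fractionalPackingNumber_le S, sampleComplexityIndex_le_one_div_lovaszNumber S⟩,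
    fun hG => le_antisymm (sampleComplexityIndex_le_of_isHbarPerfect hG)
      (one_div_fractionalPackingNumber_le S)⟩
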